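/- Let $d\ge 1$ and $n_1,\dots,n_d\ge 1$, and let $\otimes_{j=1}^d\mathbb{R}^{n_j}$ be the space of real $n_1\times\dots\times n_d$ tensors with the Frobenius inner product $\langle A,B\rangle_F=\sum a_{i_1\dots i_d}b_{i_1\dots i_d}$ and norm $\|A\|_F=\sqrt{\langle A,A\rangle_F}$. A rank-one tensor is a nonzero tensor of the form $x^{(1)}\otimes\dots\otimes x^{(d)}$ with $x^{(j)}\in\mathbb{R}^{n_j}$. The spectral norm is $$\|A\|_2=\max_{\|x^{(1)}\|=\dots=\|x^{(d)}\|=1}\langle A,x^{(1)}\otimes\dots\otimes x^{(d)}\rangle_F ,$$ where $\|\cdot\|$ is the Euclidean norm. A best rank-one approximation of $A$ is a rank-one tensor $Y$ such that $\|A-Y\|_F\le\|A-X\|_F$ for all rank-one tensors $X$. Put $\mathscr{A}=\min_{B\ne 0}\|B\|_2/\|B\|_F$, the minimum being over the nonzero tensors $B\in\otimes_{j=1}^d\mathbb{R}^{n_j}$; a nonzero tensor $A$ is called extremal if $\|A\|_2/\|A\|_F=\mathscr{A}$. For a Lipschitz function $f$ on a finite-dimensional Euclidean space, the generalized (Clarke)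 gradient $\partial f(p)$ is the convex hull of the set of all limits $\lim_i\nabla f(p_i)$, where $(p_i)$ is a sequence of points of differentiability of $f$ converging to $p$. A nonzero tensor $A$ is called critical if $A/\|A\|_F$ is a critical point of the restriction of the spectral norm to the Frobenius unit sphere, meaning that $\lambda A\in\partial\|\cdot\|_2\,(A/\|A\|_F)$ for some $\lambda\in\mathbb{R}$ (gradients are taken with respect to $\langle\cdot,\cdot\rangle_F$). **Theorem.** A nonzero tensor $A\in\otimes_{j=1}^d\mathbb{R}^{n_j}$ is critical if and only if there are $r\in\mathbb{N}$, best rank-one approximations $Y_1,\dots,Y_r$ of $A$ and real numbers $\alpha_1,\dots,\alpha_r>0$ with $\sum_{\ell=1}^r\alpha_\ell=1$ such that $$\left(\frac{\|A\|_2}{\|A\|_F}\right)^2A=\sum_{\ell=1}^r\alpha_\ell Y_\ell .$$ In particular, if $A$ is extremal, then $$\mathscr{A}^2\,A=\sum_{\ell=1}^r\alpha_\ell Y_\ell,\qquad \sum_{\ell=1}^r\alpha_\ell=1,\quad \alpha_1,\dots,\alpha_r>0,$$ for some $r\in\mathbb{N}$ and some best rank-one approximations $Y_1,\dots,Y_r$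 of $A$. -/

import Mathlib

open Filter Topology

noncomputable section

/-- The space of real `(n 0, …, n (d-1))`-tensors, as tables of real numbers. The inner product and
the norm of `EuclideanSpace` are the Frobenius inner product and the Frobenius norm. -/
abbrev RealTensor {d : ℕ} (n : Fin d → ℕ) : Type :=
  EuclideanSpace ℝ ((j : Fin d) → Fin (n j))

namespace RealTensor

variable {d : ℕ} {n : Fin d → ℕ}

/-- The outer product `x 0 ⊗ ⋯ ⊗ x (d-1)`, with entries `∏ j, (x j) (i j)`. -/
def outer (x : (j : Fin d) → EuclideanSpace ℝ (Fin (n j))) : RealTensor n :=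
  WithLp.toLp 2 (fun i => ∏ j, x j (i j))

/-- Rank-one tensors: nonzero outer products. -/
def IsRankOne (X : RealTensor n) : Prop :=
  X ≠ 0 ∧ ∃ x : (j : Fin d) → EuclideanSpace ℝ (Fin (n j)), X = outer x

/-- The values `⟨A, x 0 ⊗ ⋯ ⊗ x (d-1)⟩` over all tuples of Euclidean unit vectors. -/
def unitValues (A : RealTensor n) : Set ℝ :=
  {r | ∃ x : (j : Fin d) → EuclideanSpace ℝ (Fin (n j)),
    (∀ j, ‖x j‖ = 1) ∧ r = inner ℝ A (outer x)}

/-- The spectral norm: the maximum of `⟨A, x 0 ⊗ ⋯ ⊗ x (d-1)⟩` over tuples of unit vectors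
(see `isGreatest_specNorm` for the fact that the supremum is a maximum). -/
def specNorm (A : RealTensor n) : ℝ := sSup (unitValues A)

/-- `Y` is a best rank-one approximation to `A`. -/
def IsBestRankOneApprox (A Y : RealTensor n) : Prop :=
  IsRankOne Y ∧ ∀ X : RealTensor n, IsRankOne X → ‖A - Y‖ ≤ ‖A - X‖

/-- The best rank-one approximation ratio of the tensor space: the minimum of
`specNorm A / ‖A‖` over all nonzero tensors `A`. -/
def approxRatio (n : Fin d → ℕ) : ℝ :=
  sInf {r | ∃ A : RealTensor n, A ≠ 0 ∧ r = specNorm A / ‖A‖}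

/-- Extremal tensors: nonzero tensors at which the minimum of `specNorm A / ‖A‖` is attained. -/
def IsExtremal (A : RealTensor n) : Prop :=
  A ≠ 0 ∧ specNorm A / ‖A‖ = approxRatio n

end RealTensor

/-- The (Clarke) generalized gradient of a Lipschitz function `f` at `p`: the convex hull of all
limits of gradients of `f` along sequences of points of differentiability converging to `p`. -/
def generalizedGradient {E : Type*} [NormedAddCommGroup E] [InnerProductSpace ℝ E]
    [CompleteSpace E] (f : E → ℝ) (p : E) : Set E :=
  convexHull ℝ {g | ∃ q : ℕ → E, Tendsto q atTop (𝓝 p) ∧ (∀ i, DifferentiableAt ℝ f (q i)) ∧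
    Tendsto (fun i => gradient f (q i)) atTop (𝓝 g)}

namespace RealTensor

variable {d : ℕ} {n : Fin d → ℕ}

/-- A nonzero tensor `A` is critical if `A / ‖A‖` is a critical point of the spectral norm on the
Frobenius unit sphere: a vector normal to the sphere at `A / ‖A‖`, that is, a multiple of `A`,
lies in the generalized gradient of the spectral norm at `A / ‖A‖`. -/
def IsCritical (A : RealTensor n) : Prop :=
  A ≠ 0 ∧ ∃ c : ℝ, c • A ∈ generalizedGradient (specNorm (n := n)) (‖A‖⁻¹ • A)

/-- If all dimensions are positive, the supremum that defines the spectral norm is a maximum. -/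
theorem isGreatest_specNorm (hn : ∀ j, 0 < n j) (A : RealTensor n) :
    IsGreatest (unitValues A) (specNorm A) := by
  have hK : IsCompact (Set.univ.pi
      fun j : Fin d => Metric.sphere (0 : EuclideanSpace ℝ (Fin (n j))) 1) :=
    isCompact_univ_pi fun j => isCompact_sphere _ _
  have hc : Continuous fun x : (j : Fin d) → EuclideanSpace ℝ (Fin (n j)) =>
      inner ℝ A (outer x) := by
    unfold outer
    fun_prop
  have he : unitValues A = (fun x => inner ℝ A (outer x)) '' (Set.univ.pi
      fun j : Fin d => Metric.sphere (0 : EuclideanSpace ℝ (Fin (n j))) 1) := by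
    ext r
    simp [unitValues, eq_comm]
  have hcomp : IsCompact (unitValues A) := he ▸ hK.image hc
  refine hcomp.isGreatest_sSup ⟨_, fun j => EuclideanSpace.single ⟨0, hn j⟩ 1, ?_, rfl⟩
  intro j
  simp

end RealTensor

end

/-! The spectral norm is the support function of the compact set `unitOuter n`, which lies in the
Frobenius unit sphere. For such a function the generalized gradient at `p` is the hull of the active
points (`IsSupportFunction.generalizedGradient_eq`): every gradient is an active point, and pushing
`p` towards an active `X` makes `X` the only one. Completing the square identifies the active points
at `A`, scaled by `specNorm A`, with the best rank-one approximations (`isBestRankOneApprox_iff`).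
Pairing with `A` forces the multiplier `specNorm A / ‖A‖ ^ 2`, and scaling by `specNorm A` gives the
formula. An extremal tensor is critical: otherwise a hyperplane separating its multiple from the
hull would yield a direction that lowers the ratio. -/

section SupportFunction

variable {E : Type*} [NormedAddCommGroup E] [InnerProductSpace ℝ E]

/-- The points of `K` at which the inner product with `p` takes the value `f p`; if `f` is the
support function of `K`, this is the face of `K` exposed by `p`. -/
def activeSet (K : Set E) (f : E → ℝ) (p : E) : Set E := {X | X ∈ K ∧ inner ℝ p X = f p}

/-- `f` is the support function of `K`, and the supremum is attained everywhere. -/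
def IsSupportFunction (K : Set E) (f : E → ℝ) : Prop :=
  ∀ p, (∀ X ∈ K, inner ℝ p X ≤ f p) ∧ (activeSet K f p).Nonempty

variable {K : Set E} {f : E → ℝ}

/-- In finite dimension, the convex hull of a compact set is compact. -/
theorem IsCompact.isCompact_convexHull_of_finiteDimensional [FiniteDimensional ℝ E] {s : Set E}
    (hs : IsCompact s) : IsCompact (convexHull ℝ s) := by
  -- Carathéodory: `N` points suffice, so the hull is a continuous image of the simplex times `s ^
  -- N`.
  let N := Module.finrank ℝ E + 1
  have hc : IsCompact (stdSimplex ℝ (Fin N) ×ˢ Set.univ.pi fun _ : Fin N => s) :=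
    (isCompact_stdSimplex ℝ (Fin N)).prod (isCompact_univ_pi fun _ => hs)
  have hcont : Continuous fun q : (Fin N → ℝ) × (Fin N → E) => ∑ i, q.1 i • q.2 i := by fun_prop
  convert hc.image hcont
  ext x
  constructor
  · intro hx
    obtain ⟨ι, hι, z, w, hz, hind, hw, hw1, hx⟩ := eq_pos_convex_span_of_mem_convexHull hx
    have hcard : Fintype.card ι ≤ N := by
      refine hind.card_le_finrank_succ.trans ?_
      exact Nat.succ_le_succ (Submodule.finrank_le _)
    obtain ⟨e⟩ : Nonempty (ι ↪ Fin N) :=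
      Function.Embedding.nonempty_of_card_le (by simpa using hcard)
    have hne : Nonempty ι := by
      by_contra h
      rw [not_nonempty_iff] at h
      simp at hw1
    obtain ⟨i₀⟩ := hne
    have hz' : ∀ i, z i ∈ s := fun i => hz ⟨i, rfl⟩
    have hoff : ∀ k, k ∉ Set.range e → Function.extend e w 0 k = 0 := fun k hk =>
      Function.extend_apply' _ _ _ hk
    -- Spare slots get weight zero and the dummy point `z i₀`.
    refine ⟨(Function.extend e w 0, Function.extend e z fun _ => z i₀), ⟨⟨fun k => ?_, ?_⟩, ?_⟩, ?_⟩
    · by_cases hk : k ∈ Set.range e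
      · obtain ⟨i, rfl⟩ := hk
        simpa [e.injective.extend_apply] using (hw i).le
      · exact (hoff k hk).ge
    · rw [← hw1]
      refine (Fintype.sum_of_injective e e.injective _ _ hoff fun i => ?_).symm
      simp [e.injective.extend_apply]
    · intro k _
      by_cases hk : k ∈ Set.range e
      · obtain ⟨i, rfl⟩ := hk
        simpa [e.injective.extend_apply] using hz' i
      · simpa [Function.extend_apply' _ _ _ hk] using hz' i₀
    · rw [← hx]
      refine (Fintype.sum_of_injective e e.injective _ _ (fun k hk => ?_) fun i => ?_).symm
      · simp [hoff k hk]
      · simp [e.injective.extend_apply]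
  · rintro ⟨⟨w, z⟩, ⟨hw, hz⟩, rfl⟩
    exact mem_convexHull_of_exists_fintype w z hw.1 hw.2 (fun i => hz i trivial) rfl

theorem IsSupportFunction.continuous (hf : IsSupportFunction K f) (hK : ∀ X ∈ K, ‖X‖ = 1) :
    Continuous f := by
  refine LipschitzWith.continuous (K := 1) (LipschitzWith.of_le_add fun p q => ?_)
  obtain ⟨X, hX, hpX⟩ := (hf p).2
  have h1 := (hf q).1 X hX
  have h2 := real_inner_le_norm (p - q) X
  rw [hK X hX, inner_sub_left, ← dist_eq_norm] at h2
  linarith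

/-- Lets criticality, defined at `A / ‖A‖`, be tested at `A`. -/
theorem IsSupportFunction.activeSet_smul (hf : IsSupportFunction K f) {c : ℝ} (hc : 0 < c) (p : E) :
    activeSet K f (c • p) = activeSet K f p := by
  have hfc : f (c • p) = c * f p := by
    apply le_antisymm
    · obtain ⟨X, hX, h⟩ := (hf (c • p)).2
      rw [← h, real_inner_smul_left]
      exact mul_le_mul_of_nonneg_left ((hf p).1 X hX) hc.le
    · obtain ⟨X, hX, h⟩ := (hf p).2
      rw [← h, ← real_inner_smul_left]
      exact (hf (c • p)).1 X hX
  ext X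
  simp [activeSet, hfc, real_inner_smul_left, hc.ne']

theorem isCompact_activeSet (hKc : IsCompact K) (p : E) : IsCompact (activeSet K f p) :=
  hKc.inter_right (isClosed_eq (by fun_prop) continuous_const)

/-- The inner product with `p` is constant on the convex hull of the active set at `p`. -/
theorem inner_of_mem_convexHull_activeSet {p g : E} (hg : g ∈ convexHull ℝ (activeSet K f p)) :
    inner ℝ p g = f p := by
  have hconv : Convex ℝ {x : E | inner ℝ p x = f p} :=
    convex_hyperplane (innerSL ℝ p).toLinearMap.isLinear _
  exact convexHull_min (fun X hX => hX.2) hconv hg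

variable [CompleteSpace E]

/-- At a point of differentiability, each active point is the gradient. -/
theorem IsSupportFunction.gradient_eq (hf : IsSupportFunction K f) {p X : E}
    (hd : DifferentiableAt ℝ f p) (hX : X ∈ activeSet K f p) : gradient f p = X := by
  -- The difference is nonnegative everywhere and vanishes at `p`.
  have hmin : IsLocalMin (fun y => f y - innerSL ℝ X y) p := by
    refine Eventually.of_forall fun y => ?_
    have h1 := (hf y).1 X hX.1
    have h2 := hX.2
    simp only [innerSL_apply_apply]
    rw [real_inner_comm] at h1 h2
    linarith
  have h0 := hmin.hasFDerivAt_eq_zero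
    (hd.hasGradientAt.hasFDerivAt.sub (innerSL ℝ X).hasFDerivAt)
  refine ext_inner_right ℝ fun v => ?_
  have := DFunLike.congr_fun h0 v
  simpa [sub_eq_zero] using this

/-- If `K` lies in the unit sphere and `X` is active at `p`, then moving `p` in the direction of `X`
makes `X` the only active point, so that the support function becomes differentiable. -/
theorem IsSupportFunction.hasGradientAt_add_smul (hf : IsSupportFunction K f)
    (hK : ∀ X ∈ K, ‖X‖ = 1) {p X : E} (hX : X ∈ activeSet K f p) {t : ℝ} (ht : 0 < t) :
    HasGradientAt f X (p + t • X) := by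
  have hXX : inner ℝ X X = (1 : ℝ) := by rw [real_inner_self_eq_norm_sq, hK X hX.1]; norm_num
  have hval : f (p + t • X) = f p + t := by
    apply le_antisymm
    · obtain ⟨Z, hZ, h⟩ := (hf (p + t • X)).2
      have h1 := (hf p).1 Z hZ
      have h2 := real_inner_le_norm X Z
      rw [hK X hX.1, hK Z hZ] at h2
      rw [← h, inner_add_left, real_inner_smul_left]
      nlinarith
    · have h := (hf (p + t • X)).1 X hX.1
      rwa [inner_add_left, real_inner_smul_left, hX.2, hXX, mul_one] at h
  rw [hasGradientAt_iff_isLittleO_nhds_zero]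
  -- Comparing `X` with a point `Z` active after the shift by `h` gives `t * (1 - ⟪X, Z⟫) ≤ ⟪h, Z -
  -- X⟫`. On the unit sphere the left side is `t / 2 * ‖X - Z‖ ^ 2`, so `‖X - Z‖ ≤ 2 / t * ‖h‖`; the
  -- error lies between `0` and `⟪h, Z - X⟫`.
  have hbound : ∀ h : E, ‖f (p + t • X + h) - f (p + t • X) - inner ℝ X h‖ ≤ 2 / t * ‖h‖ ^ 2 := by
    intro h
    obtain ⟨Z, hZ, hZa⟩ := (hf (p + t • X + h)).2
    have h1 := (hf p).1 Z hZ
    have h2 := (hf (p + t • X + h)).1 X hX.1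
    have h3 : ‖X - Z‖ ^ 2 = 2 - 2 * inner ℝ X Z := by
      rw [norm_sub_sq_real, hK X hX.1, hK Z hZ]; ring
    have h4 := real_inner_le_norm h (Z - X)
    rw [norm_sub_rev Z X, inner_sub_right] at h4
    have h5 := hX.2
    rw [← hZa] at h2
    simp only [inner_add_left, real_inner_smul_left] at h2 hZa
    rw [hXX] at h2
    have hdist : ‖X - Z‖ ≤ 2 / t * ‖h‖ := by
      have h6 : t * ‖X - Z‖ ^ 2 ≤ 2 * ‖h‖ * ‖X - Z‖ := by rw [h3]; linarith
      rcases (norm_nonneg (X - Z)).eq_or_lt with h0 | h0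
      · rw [← h0]; positivity
      · rw [div_mul_eq_mul_div, le_div_iff₀ ht]
        refine le_of_mul_le_mul_right ?_ h0
        linarith
    have h7 : t * inner ℝ X Z ≤ t := by
      have : inner ℝ X Z ≤ (1 : ℝ) := by nlinarith [sq_nonneg ‖X - Z‖]
      nlinarith
    have h8 := mul_le_mul_of_nonneg_left hdist (norm_nonneg h)
    rw [Real.norm_eq_abs, abs_le, real_inner_comm h X, hval, ← hZa]
    have h9 : 0 ≤ 2 / t * ‖h‖ ^ 2 := by positivity
    constructor <;> nlinarith
  refine (Asymptotics.IsBigO.of_bound (2 / t) (Eventually.of_forall fun h => ?_)).trans_isLittleO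
    (Asymptotics.isLittleO_norm_pow_id one_lt_two)
  simpa using hbound h

/-- The generalized gradient of the support function of a compact subset of the unit sphere is the
convex hull of the active set. -/
theorem IsSupportFunction.generalizedGradient_eq (hf : IsSupportFunction K f)
    (hKc : IsCompact K) (hK : ∀ X ∈ K, ‖X‖ = 1) (p : E) :
    generalizedGradient f p = convexHull ℝ (activeSet K f p) := by
  unfold generalizedGradient
  congr 1
  ext X
  constructor
  · rintro ⟨q, hq, hd, hg⟩
    have hact : ∀ i, gradient f (q i) ∈ activeSet K f (q i) := fun i => by
      obtain ⟨Z, hZ⟩ := (hf (q i)).2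
      rwa [hf.gradient_eq (hd i) hZ]
    refine ⟨hKc.isClosed.mem_of_tendsto hg (Eventually.of_forall fun i => (hact i).1), ?_⟩
    refine tendsto_nhds_unique (hq.inner hg) ?_
    refine (((hf.continuous hK).tendsto p).comp hq).congr fun i => ?_
    exact (hact i).2.symm
  · intro hX
    have hgrad : ∀ i : ℕ, HasGradientAt f X (p + (1 / ((i : ℝ) + 1)) • X) := fun i =>
      hf.hasGradientAt_add_smul hK hX (by positivity)
    refine ⟨fun i => p + (1 / ((i : ℝ) + 1)) • X, ?_, fun i => (hgrad i).differentiableAt, ?_⟩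
    · simpa using (tendsto_const_nhds (x := p)).add
        ((tendsto_one_div_add_atTop_nhds_zero_nat (𝕜 := ℝ)).smul_const X)
    · exact tendsto_const_nhds.congr fun i => (hgrad i).gradient.symm

/-- If `A` minimizes the support function relative to the norm, then the multiple of `A` with the
right inner product with `A` lies in the convex hull of the active set at `A`. -/
theorem IsSupportFunction.smul_mem_convexHull_of_isMin [FiniteDimensional ℝ E]
    (hf : IsSupportFunction K f) (hKc : IsCompact K) (hK : ∀ X ∈ K, ‖X‖ = 1) {A : E} (hA : A ≠ 0)
    (hfA : 0 ≤ f A) (hmin : ∀ B, B ≠ 0 → f A / ‖A‖ ≤ f B / ‖B‖) :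
    (f A / ‖A‖ ^ 2) • A ∈ convexHull ℝ (activeSet K f A) := by
  by_contra hnot
  have hA0 : 0 < ‖A‖ := norm_pos_iff.2 hA
  have hAA : inner ℝ A ((f A / ‖A‖ ^ 2) • A) = f A := by
    rw [real_inner_smul_right, real_inner_self_eq_norm_sq]; field_simp
  obtain ⟨φ, u, hφ, hu⟩ := geometric_hahn_banach_closed_point (convex_convexHull ℝ _)
    (isCompact_activeSet hKc A).isCompact_convexHull_of_finiteDimensional.isClosed hnot
  set B₀ := (InnerProductSpace.toDual ℝ E).symm φ with hB₀
  have hin : ∀ v, inner ℝ B₀ v = φ v := fun v => InnerProductSpace.toDual_symm_apply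
  set s := inner ℝ B₀ A / ‖A‖ ^ 2 with hs
  -- Removing the `A`-component makes `B` tangent to the sphere. The separation survives, since all
  -- points compared have the same inner product `f A` with `A`.
  set B := B₀ - s • A with hB
  have hBA : inner ℝ B A = 0 := by
    rw [hB, inner_sub_left, real_inner_smul_left, real_inner_self_eq_norm_sq, hs]; field_simp; ring
  have hneg : ∀ X ∈ activeSet K f A, inner ℝ B X < 0 := by
    intro X hX
    have h1 := hφ X (subset_convexHull ℝ _ hX)
    have h2 : inner ℝ B ((f A / ‖A‖ ^ 2) • A) = 0 := by rw [real_inner_smul_right, hBA, mul_zero]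
    rw [hB, inner_sub_left, real_inner_smul_left, hAA, hin] at h2
    rw [hB, inner_sub_left, real_inner_smul_left, hX.2, hin]
    linarith
  let t : ℕ → ℝ := fun i => 1 / ((i : ℝ) + 1)
  have ht : ∀ i, 0 < t i := fun i => by positivity
  choose Z hZ using fun i => (hf (A + t i • B)).2
  -- A tangential move does not shorten `A`, so by minimality it cannot lower `f`. A limit of the `Z
  -- i` will then contradict `hneg`.
  have hpos : ∀ i, 0 ≤ inner ℝ B (Z i) := by
    intro i
    have hnorm : ‖A‖ ≤ ‖A + t i • B‖ := by
      have h1 : ‖A + t i • B‖ ^ 2 = ‖A‖ ^ 2 + ‖t i • B‖ ^ 2 := by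
        rw [norm_add_sq_real, real_inner_smul_right, real_inner_comm, hBA]; ring
      exact le_of_sq_le_sq (by nlinarith [sq_nonneg ‖t i • B‖]) (norm_nonneg _)
    have hpos' : 0 < ‖A + t i • B‖ := hA0.trans_le hnorm
    have h2 := hmin _ (norm_pos_iff.1 hpos')
    have h3 : f A ≤ f (A + t i • B) := by
      rw [le_div_iff₀ hpos', div_mul_eq_mul_div, div_le_iff₀ hA0] at h2
      have := mul_le_mul_of_nonneg_left hnorm hfA
      exact le_of_mul_le_mul_right (this.trans h2) hA0
    have h4 := (hZ i).2
    have h5 := (hf A).1 _ (hZ i).1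
    rw [inner_add_left, real_inner_smul_left] at h4
    have h6 : 0 ≤ t i * inner ℝ B (Z i) := by linarith
    exact nonneg_of_mul_nonneg_right h6 (ht i)
  obtain ⟨X, hXK, ψ, hψ, hlim⟩ := hKc.tendsto_subseq fun i => (hZ i).1
  have hq : Tendsto (fun i => A + t (ψ i) • B) atTop (𝓝 A) := by
    simpa [t] using (tendsto_const_nhds (x := A)).add
      (((tendsto_one_div_add_atTop_nhds_zero_nat (𝕜 := ℝ)).comp hψ.tendsto_atTop).smul_const B)
  have hX : X ∈ activeSet K f A := by
    refine ⟨hXK, tendsto_nhds_unique (hq.inner hlim) ?_⟩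
    refine (((hf.continuous hK).tendsto A).comp hq).congr fun i => ?_
    exact (hZ (ψ i)).2.symm
  refine (hneg X hX).not_ge (ge_of_tendsto' (tendsto_const_nhds.inner hlim) fun i => hpos (ψ i))

end SupportFunction

/-! ### Outer products of unit vectors and best rank-one approximations -/

namespace RealTensor

variable {d : ℕ} {n : Fin d → ℕ}

/-- The outer products of unit vectors. -/
def unitOuter (n : Fin d → ℕ) : Set (RealTensor n) :=
  {X | ∃ x : (j : Fin d) → EuclideanSpace ℝ (Fin (n j)), (∀ j, ‖x j‖ = 1) ∧ X = outer x}

theorem norm_outer (x : (j : Fin d) → EuclideanSpace ℝ (Fin (n j))) :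
    ‖outer x‖ = ∏ j, ‖x j‖ := by
  have h : ‖outer x‖ ^ 2 = (∏ j, ‖x j‖) ^ 2 := by
    rw [EuclideanSpace.norm_sq_eq, ← Finset.prod_pow]
    simp only [EuclideanSpace.norm_sq_eq]
    rw [Fintype.prod_sum]
    simp [outer, Finset.prod_pow, ← Finset.abs_prod]
  exact (sq_eq_sq₀ (norm_nonneg _) (Finset.prod_nonneg fun _ _ => norm_nonneg _)).1 h

theorem outer_smul (c : Fin d → ℝ) (x : (j : Fin d) → EuclideanSpace ℝ (Fin (n j))) :
    outer (fun j => c j • x j) = (∏ j, c j) • outer x := by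
  ext i
  simp [outer, Finset.prod_mul_distrib]

theorem norm_of_mem_unitOuter {X : RealTensor n} (hX : X ∈ unitOuter n) : ‖X‖ = 1 := by
  obtain ⟨x, hx, rfl⟩ := hX
  simp [norm_outer, hx]

theorem isCompact_unitOuter : IsCompact (unitOuter n) := by
  have hK : IsCompact (Set.univ.pi
      fun j : Fin d => Metric.sphere (0 : EuclideanSpace ℝ (Fin (n j))) 1) :=
    isCompact_univ_pi fun j => isCompact_sphere _ _
  have hc : Continuous fun x : (j : Fin d) → EuclideanSpace ℝ (Fin (n j)) => outer x := by
    unfold outer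
    fun_prop
  convert hK.image hc using 1
  ext X
  simp [unitOuter, eq_comm]

theorem isSupportFunction_specNorm (hn : ∀ j, 0 < n j) :
    IsSupportFunction (unitOuter n) (specNorm (n := n)) := by
  intro p
  obtain ⟨⟨x, hx, h⟩, hub⟩ := isGreatest_specNorm hn p
  refine ⟨?_, outer x, ⟨x, hx, rfl⟩, h.symm⟩
  rintro X ⟨y, hy, rfl⟩
  exact hub ⟨y, hy, rfl⟩

theorem dim_pos_of_ne_zero {A : RealTensor n} (hA : A ≠ 0) (j : Fin d) : 0 < n j := by
  by_contra h
  have h0 : n j = 0 := by omega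
  apply hA
  ext i
  exact (Fin.cast h0 (i j)).elim0

theorem outer_single (i : (j : Fin d) → Fin (n j)) :
    outer (fun j => EuclideanSpace.single (i j) (1 : ℝ)) = EuclideanSpace.single i 1 := by
  ext k
  by_cases h : k = i
  · subst h
    simp [outer]
  · obtain ⟨j, hj⟩ := Function.ne_iff.1 h
    rw [PiLp.single_apply, if_neg h]
    exact Finset.prod_eq_zero (Finset.mem_univ j) (by simp [hj])

theorem neg_mem_unitOuter (hd : 0 < d) {X : RealTensor n} (hX : X ∈ unitOuter n) :
    -X ∈ unitOuter n := by
  obtain ⟨x, hx, rfl⟩ := hX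
  let c : Fin d → ℝ := fun j => if j = ⟨0, hd⟩ then -1 else 1
  refine ⟨fun j => c j • x j, fun j => ?_, ?_⟩
  · by_cases hj : j = ⟨0, hd⟩ <;> simp [c, hx, hj]
  · rw [outer_smul]
    simp [c]

/-- A nonzero entry of `A` is its pairing with a coordinate tensor, and the sign can be flipped. For
`d = 0` no flip is possible, and the spectral norm is the single entry, possibly negative. -/
theorem specNorm_pos (hd : 0 < d) {A : RealTensor n} (hA : A ≠ 0) : 0 < specNorm A := by
  obtain ⟨i, hi⟩ : ∃ i, A i ≠ 0 := by
    by_contra! h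
    exact hA (by ext i; exact h i)
  have hmem : (EuclideanSpace.single i 1 : RealTensor n) ∈ unitOuter n :=
    ⟨_, fun j => by simp, (outer_single i).symm⟩
  have hf := (isSupportFunction_specNorm (dim_pos_of_ne_zero hA) A).1
  have h1 := hf _ hmem
  have h2 := hf _ (neg_mem_unitOuter hd hmem)
  simp only [inner_neg_right, EuclideanSpace.inner_single_right] at h1 h2
  simp at h1 h2
  rcases lt_or_gt_of_ne hi with h | h <;> linarith

/-- A rank-one tensor is a positive multiple of an outer product of unit vectors. -/
theorem IsRankOne.exists_smul_unitOuter {Y : RealTensor n} (hY : IsRankOne Y) :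
    ∃ X ∈ unitOuter n, Y = ‖Y‖ • X := by
  obtain ⟨h0, x, rfl⟩ := hY
  have hne : ∏ j, ‖x j‖ ≠ 0 := by
    rw [← norm_outer]
    exact norm_ne_zero_iff.2 h0
  refine ⟨outer fun j => ‖x j‖⁻¹ • x j, ⟨_, fun j => ?_, rfl⟩, ?_⟩
  · have hj : ‖x j‖ ≠ 0 := fun h => hne (Finset.prod_eq_zero (Finset.mem_univ j) h)
    rw [norm_smul, norm_inv, norm_norm, inv_mul_cancel₀ hj]
  · rw [outer_smul, norm_outer, smul_smul, Finset.prod_inv_distrib, mul_inv_cancel₀ hne, one_smul]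

theorem isRankOne_smul (hd : 0 < d) {X : RealTensor n} (hX : X ∈ unitOuter n) {c : ℝ}
    (hc : c ≠ 0) : IsRankOne (c • X) := by
  refine ⟨smul_ne_zero hc fun h => ?_, ?_⟩
  · have := norm_of_mem_unitOuter hX
    simp [h] at this
  · obtain ⟨x, -, rfl⟩ := hX
    refine ⟨fun j => (if j = ⟨0, hd⟩ then c else 1) • x j, ?_⟩
    rw [outer_smul]
    simp

theorem norm_sub_smul_sq (A : RealTensor n) {X : RealTensor n} (hX : X ∈ unitOuter n) (c : ℝ) :
    ‖A - c • X‖ ^ 2 = ‖A‖ ^ 2 - 2 * c * inner ℝ A X + c ^ 2 := by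
  rw [norm_sub_sq_real, real_inner_smul_right, norm_smul, norm_of_mem_unitOuter hX, mul_one,
    Real.norm_eq_abs, sq_abs]
  ring

/-- The best rank-one approximations to a nonzero tensor are the multiples, by its spectral norm, of
the outer products of unit vectors at which the spectral norm is attained. -/
theorem isBestRankOneApprox_iff (hd : 0 < d) {A : RealTensor n} (hA : A ≠ 0) (Y : RealTensor n) :
    IsBestRankOneApprox A Y ↔
      ∃ X ∈ activeSet (unitOuter n) specNorm A, Y = specNorm A • X := by
  have hf := isSupportFunction_specNorm (dim_pos_of_ne_zero hA) A
  have hpos := specNorm_pos hd hA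
  constructor
  · rintro ⟨h1, h2⟩
    obtain ⟨X, hX, hYX⟩ := h1.exists_smul_unitOuter
    obtain ⟨Z, hZ, hZA⟩ := hf.2
    have h3 := pow_le_pow_left₀ (norm_nonneg _) (h2 _ (isRankOne_smul hd hZ hpos.ne')) 2
    have hY0 : 0 < ‖Y‖ := norm_pos_iff.2 h1.1
    have h4 := hf.1 X hX
    rw [norm_sub_smul_sq A hZ, hZA] at h3
    have h5 := norm_sub_smul_sq A hX ‖Y‖
    rw [← hYX] at h5
    have h6 := mul_le_mul_of_nonneg_left h4 hY0.le
    have h7 : ‖Y‖ = specNorm A := by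
      -- Comparison with the competitor `specNorm A • Z`, whose squared distance to `A` is `‖A‖ ^ 2
      -- - specNorm A ^ 2`.
      have : (‖Y‖ - specNorm A) ^ 2 ≤ 0 := by nlinarith
      exact sub_eq_zero.1 (pow_eq_zero_iff two_ne_zero |>.1 (le_antisymm this (sq_nonneg _)))
    rw [h7] at h5 h6 hYX
    refine ⟨X, ⟨hX, le_antisymm h4 ?_⟩, hYX⟩
    refine le_of_mul_le_mul_left ?_ hpos
    nlinarith
  · rintro ⟨X, ⟨hX, hXA⟩, rfl⟩
    refine ⟨isRankOne_smul hd hX hpos.ne', fun W hW => ?_⟩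
    obtain ⟨Z, hZ, hWZ⟩ := hW.exists_smul_unitOuter
    refine le_of_sq_le_sq ?_ (norm_nonneg _)
    have h5 := norm_sub_smul_sq A hZ ‖W‖
    rw [← hWZ] at h5
    rw [norm_sub_smul_sq A hX, hXA, h5]
    have h6 := mul_le_mul_of_nonneg_left (hf.1 Z hZ) (norm_nonneg W)
    nlinarith [sq_nonneg (‖W‖ - specNorm A)]

/-! ### Critical and extremal tensors -/

/-- A nonzero tensor is critical if and only if its multiple with the right inner product with `A`
is a convex combination of outer products of unit vectors where the spectral norm is attained. -/
theorem isCritical_iff {A : RealTensor n} (hA : A ≠ 0) :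
    IsCritical A ↔
      (specNorm A / ‖A‖ ^ 2) • A ∈ convexHull ℝ (activeSet (unitOuter n) specNorm A) := by
  have hf := isSupportFunction_specNorm (dim_pos_of_ne_zero hA)
  have hA0 : 0 < ‖A‖ := norm_pos_iff.2 hA
  have hgrad : generalizedGradient (specNorm (n := n)) (‖A‖⁻¹ • A) =
      convexHull ℝ (activeSet (unitOuter n) specNorm A) := by
    rw [hf.generalizedGradient_eq isCompact_unitOuter fun X hX => norm_of_mem_unitOuter hX,
      hf.activeSet_smul (inv_pos.2 hA0)]
  rw [IsCritical, hgrad]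
  refine ⟨fun ⟨_, c, hc⟩ => ?_, fun h => ⟨hA, _, h⟩⟩
  -- Pairing with `A` determines `c`.
  have h1 := inner_of_mem_convexHull_activeSet hc
  rw [real_inner_smul_right, real_inner_self_eq_norm_sq] at h1
  rwa [← h1, mul_div_cancel_right₀ _ (by positivity)]

theorem smul_mem_convexHull_activeSet_iff (hd : 0 < d) {A : RealTensor n} (hA : A ≠ 0) :
    (specNorm A / ‖A‖ ^ 2) • A ∈ convexHull ℝ (activeSet (unitOuter n) specNorm A) ↔
      ∃ (r : ℕ) (α : Fin r → ℝ) (Y : Fin r → RealTensor n),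
        (∀ l, 0 < α l) ∧ ∑ l, α l = 1 ∧ (∀ l, IsBestRankOneApprox A (Y l)) ∧
        (specNorm A / ‖A‖) ^ 2 • A = ∑ l, α l • Y l := by
  have hpos := specNorm_pos hd hA
  have hscale : (specNorm A / ‖A‖) ^ 2 • A = specNorm A • (specNorm A / ‖A‖ ^ 2) • A := by
    rw [smul_smul]
    congr 1
    ring
  rw [hscale]
  constructor
  · intro h
    obtain ⟨ι, hι, z, w, hz, -, hw, hw1, hx⟩ := eq_pos_convex_span_of_mem_convexHull h
    let e := (Fintype.equivFin ι).symm
    refine ⟨Fintype.card ι, w ∘ e, fun l => specNorm A • z (e l), fun l => hw _, ?_, fun l => ?_, ?_⟩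
    · rw [← hw1]
      exact e.sum_comp w
    · exact (isBestRankOneApprox_iff hd hA _).2 ⟨_, hz ⟨_, rfl⟩, rfl⟩
    · rw [← hx, Finset.smul_sum, ← e.sum_comp]
      exact Finset.sum_congr rfl fun l _ => smul_comm _ _ _
  · rintro ⟨r, α, Y, hα, hα1, hY, hsum⟩
    choose X hX hYX using fun l => (isBestRankOneApprox_iff hd hA (Y l)).1 (hY l)
    refine mem_convexHull_of_exists_fintype α X (fun l => (hα l).le) hα1 hX ?_
    refine smul_right_injective _ hpos.ne' ?_
    dsimp only
    rw [hsum, Finset.smul_sum]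
    exact Finset.sum_congr rfl fun l _ => by rw [hYX l, smul_comm]

theorem approxRatio_le (hd : 0 < d) {B : RealTensor n} (hB : B ≠ 0) :
    approxRatio n ≤ specNorm B / ‖B‖ := by
  refine csInf_le ⟨0, ?_⟩ ⟨B, hB, rfl⟩
  rintro r ⟨C, hC, rfl⟩
  exact div_nonneg (specNorm_pos hd hC).le (norm_nonneg C)

theorem IsExtremal.isCritical (hd : 0 < d) {A : RealTensor n} (h : IsExtremal A) :
    IsCritical A :=
  (isCritical_iff h.1).2 <|
    (isSupportFunction_specNorm (dim_pos_of_ne_zero h.1)).smul_mem_convexHull_of_isMin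
      isCompact_unitOuter (fun _ hX => norm_of_mem_unitOuter hX) h.1 (specNorm_pos hd h.1).le
      fun _ hB => h.2.trans_le (approxRatio_le hd hB)

end RealTensor

theorem mainTheorem4 (d : ℕ) (hd : 0 < d) (n : Fin d → ℕ) (A : RealTensor n) (hA : A ≠ 0) :
    (RealTensor.IsCritical A ↔
      ∃ (r : ℕ) (α : Fin r → ℝ) (Y : Fin r → RealTensor n),
        (∀ l, 0 < α l) ∧ ∑ l, α l = 1 ∧ (∀ l, RealTensor.IsBestRankOneApprox A (Y l)) ∧
        (RealTensor.specNorm A / ‖A‖) ^ 2 • A = ∑ l, α l • Y l) ∧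
    (RealTensor.IsExtremal A →
      ∃ (r : ℕ) (α : Fin r → ℝ) (Y : Fin r → RealTensor n),
        (∀ l, 0 < α l) ∧ ∑ l, α l = 1 ∧ (∀ l, RealTensor.IsBestRankOneApprox A (Y l)) ∧
        RealTensor.approxRatio n ^ 2 • A = ∑ l, α l • Y l) := by
  have h : RealTensor.IsCritical A ↔ _ :=
    (RealTensor.isCritical_iff hA).trans (RealTensor.smul_mem_convexHull_activeSet_iff hd hA)
  refine ⟨h, fun hE => ?_⟩
  rw [← hE.2]
  exact h.1 (hE.isCritical hd)
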